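/- Let $M$ be a smooth manifold of dimension $n>1$ with a paracontact metric structure $(\phi,\xi,\eta,g)$. This means that $\phi$ is a smooth $(1,1)$-tensor field, $\xi$ a smooth vector field, $\eta$ a smooth $1$-form and $g$ a smooth pseudo-Riemannian metric with $$\phi^2=I-\eta\otimes\xi,\qquad \eta(\xi)=1,\qquad \phi(\xi)=0,\qquad \eta\circ\phi=0,$$ $$g(\phi X,\phi Y)=-g(X,Y)+\eta(X)\eta(Y),\qquad g(X,\phi Y)=d\eta(X,Y)$$ for all smooth vector fields $X,Y$, where $d\eta(X,Y)=\tfrac12\bigl(X\eta(Y)-Y\eta(X)-\eta([X,Y])\bigr)$. Suppose that $g$ is a $\delta$-almost Yamabe soliton with potential vector field $Z$, that is, $Z$ is a smooth vector field, $\lambda$ is a smooth function and $\delta$ is a nowhere vanishing function on $M$ such that $$\frac{\delta}{2}\,\mathfrak{L}_Z g=(r-\lambda)\,g,$$ where $r$ is the scalar curvature of $g$. Suppose also that $Z$ is an infinitesimal contact transformation, that is, $\mathfrak{L}_Z\eta=\sigma\eta$ for some smooth function $\sigma$ on $M$. Then $r=\lambda$ on all of $M$, and $Z$ is a Killing vector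 field, that is, $\mathfrak{L}_Zg=0$. -/

import Mathlib

open scoped Manifold ContDiff Bundle
open Bundle

noncomputable section

/-! ## Vector fields and tensor fields on a smooth manifold modelled on `ℝⁿ` -/

section Basic

variable {n : ℕ} {M : Type*} [TopologicalSpace M] [ChartedSpace (EuclideanSpace ℝ (Fin n)) M]
  [IsManifold (𝓡 n) ∞ M]

/-- The vector field `X` on `M` is smooth. -/
def SmoothField (X : ∀ x : M, TangentSpace (𝓡 n) x) : Prop :=
  ContMDiff (𝓡 n) ((𝓡 n).prod 𝓘(ℝ, EuclideanSpace ℝ (Fin n))) ∞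
    (fun x => TotalSpace.mk' (EuclideanSpace ℝ (Fin n))
      (E := fun x : M => TangentSpace (𝓡 n) x) x (X x))

/-- The derivative `X f` of a function `f` along a vector field `X`. -/
def derivAlong (X : ∀ x : M, TangentSpace (𝓡 n) x) (f : M → ℝ) (x : M) : ℝ :=
  mvfderiv (𝓡 n) f x (X x)

/-- The Lie derivative of a `1`-form:
`(𝔏_Z η)(X) = Z (η X) - η [Z, X]`. -/
def lieDerivOneForm (Z : ∀ x : M, TangentSpace (𝓡 n) x)
    (η : ∀ x : M, TangentSpace (𝓡 n) x →L[ℝ] ℝ)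
    (X : ∀ x : M, TangentSpace (𝓡 n) x) (x : M) : ℝ :=
  derivAlong Z (fun y => η y (X y)) x - η x (VectorField.mlieBracket (𝓡 n) Z X x)

/-- The exterior derivative of a `1`-form, with the normalization
`2 dη(X, Y) = X (η Y) - Y (η X) - η [X, Y]`. -/
def extDerivOneForm (η : ∀ x : M, TangentSpace (𝓡 n) x →L[ℝ] ℝ)
    (X Y : ∀ x : M, TangentSpace (𝓡 n) x) (x : M) : ℝ :=
  (1 / 2) * (derivAlong X (fun y => η y (Y y)) x - derivAlong Y (fun y => η y (X y)) x
    - η x (VectorField.mlieBracket (𝓡 n) X Y x))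

/-- `Z` is an infinitesimal contact transformation for `η`: `𝔏_Z η = σ η` for some smooth
function `σ`. -/
def IsInfinitesimalContactTransformation (η : ∀ x : M, TangentSpace (𝓡 n) x →L[ℝ] ℝ)
    (Z : ∀ x : M, TangentSpace (𝓡 n) x) : Prop :=
  ∃ σ : M → ℝ, ContMDiff (𝓡 n) 𝓘(ℝ, ℝ) ∞ σ ∧
    ∀ X : ∀ x : M, TangentSpace (𝓡 n) x, SmoothField X →
      ∀ x, lieDerivOneForm Z η X x = σ x * η x (X x)

end Basic

/-! ## Scalar curvature of a metric in coordinates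

`G y` is the matrix of the coefficients `g_{ij}(y)` of a metric on (an open part of) `ℝⁿ`. -/

section Coordinates

variable {n : ℕ}

/-- The partial derivative `∂_i f`. -/
def partialDeriv (i : Fin n) (f : EuclideanSpace ℝ (Fin n) → ℝ)
    (y : EuclideanSpace ℝ (Fin n)) : ℝ :=
  fderiv ℝ f y (EuclideanSpace.single i 1)

/-- The Christoffel symbol `Γ^k_{ij} = ½ g^{kl} (∂_i g_{jl} + ∂_j g_{il} - ∂_l g_{ij})` of the
Levi-Civita connection. -/
def christoffel (G : EuclideanSpace ℝ (Fin n) → Matrix (Fin n) (Fin n) ℝ) (k i j : Fin n)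
    (y : EuclideanSpace ℝ (Fin n)) : ℝ :=
  (1 / 2) * ∑ l, (G y)⁻¹ k l *
    (partialDeriv i (fun z => G z j l) y + partialDeriv j (fun z => G z i l) y
      - partialDeriv l (fun z => G z i j) y)

/-- The component along `∂_l` of `R(∂_i, ∂_j) ∂_k`, where
`R(X, Y) = [∇_X, ∇_Y] - ∇_{[X, Y]}`. -/
def riemannCoeff (G : EuclideanSpace ℝ (Fin n) → Matrix (Fin n) (Fin n) ℝ) (l k i j : Fin n)
    (y : EuclideanSpace ℝ (Fin n)) : ℝ :=
  partialDeriv i (christoffel G l j k) y - partialDeriv j (christoffel G l i k) y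
    + ∑ m, (christoffel G l i m y * christoffel G m j k y
      - christoffel G l j m y * christoffel G m i k y)

/-- The Ricci tensor `S(∂_j, ∂_k)`, the trace of `X ↦ R(X, ∂_j) ∂_k`. -/
def ricciCoeff (G : EuclideanSpace ℝ (Fin n) → Matrix (Fin n) (Fin n) ℝ) (j k : Fin n)
    (y : EuclideanSpace ℝ (Fin n)) : ℝ :=
  ∑ i, riemannCoeff G i k i j y

/-- The scalar curvature `g^{jk} S_{jk}`. -/
def scalarCoeff (G : EuclideanSpace ℝ (Fin n) → Matrix (Fin n) (Fin n) ℝ)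
    (y : EuclideanSpace ℝ (Fin n)) : ℝ :=
  ∑ j, ∑ k, (G y)⁻¹ j k * ricciCoeff G j k y

end Coordinates

/-! ## Pseudo-Riemannian metrics -/

/-- A smooth pseudo-Riemannian metric: a smooth field of nondegenerate symmetric bilinear forms
on the tangent spaces. -/
structure PseudoRiemannianMetric (n : ℕ) (M : Type*) [TopologicalSpace M]
    [ChartedSpace (EuclideanSpace ℝ (Fin n)) M] [IsManifold (𝓡 n) ∞ M] where
  val : ∀ x : M, TangentSpace (𝓡 n) x →L[ℝ] TangentSpace (𝓡 n) x →L[ℝ] ℝ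
  symm : ∀ (x : M) (u v : TangentSpace (𝓡 n) x), val x u v = val x v u
  nondegenerate : ∀ (x : M) (u : TangentSpace (𝓡 n) x), (∀ v, val x u v = 0) → u = 0
  smooth : ContMDiff (𝓡 n)
    ((𝓡 n).prod 𝓘(ℝ, EuclideanSpace ℝ (Fin n) →L[ℝ] EuclideanSpace ℝ (Fin n) →L[ℝ] ℝ)) ∞
    (fun x => TotalSpace.mk' (EuclideanSpace ℝ (Fin n) →L[ℝ] EuclideanSpace ℝ (Fin n) →L[ℝ] ℝ)
      (E := fun x : M => TangentSpace (𝓡 n) x →L[ℝ] TangentSpace (𝓡 n) x →L[ℝ] ℝ) x (val x))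

namespace PseudoRiemannianMetric

variable {n : ℕ} {M : Type*} [TopologicalSpace M] [ChartedSpace (EuclideanSpace ℝ (Fin n)) M]
  [IsManifold (𝓡 n) ∞ M]

/-- The coefficients `g_{ij} = g(∂_i, ∂_j)` in the preferred chart at `p`; the coordinate field
`∂_i` is the image of the `i`-th basis vector under the differential of the inverse chart. -/
def gram (g : PseudoRiemannianMetric n M) (p : M) (y : EuclideanSpace ℝ (Fin n)) :
    Matrix (Fin n) (Fin n) ℝ :=
  Matrix.of fun i j =>
    g.val ((extChartAt (𝓡 n) p).symm y)
      (mfderiv 𝓘(ℝ, EuclideanSpace ℝ (Fin n)) (𝓡 n) (extChartAt (𝓡 n) p).symm y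
        (EuclideanSpace.single i (1 : ℝ) : EuclideanSpace ℝ (Fin n)))
      (mfderiv 𝓘(ℝ, EuclideanSpace ℝ (Fin n)) (𝓡 n) (extChartAt (𝓡 n) p).symm y
        (EuclideanSpace.single j (1 : ℝ) : EuclideanSpace ℝ (Fin n)))

/-- The scalar curvature of `g` at `p`, computed in the preferred chart at `p` (the value does not
depend on the chart). -/
def scalarCurvature (g : PseudoRiemannianMetric n M) (p : M) : ℝ :=
  scalarCoeff (g.gram p) (extChartAt (𝓡 n) p p)

/-- The Lie derivative of the metric:
`(𝔏_Z g)(X, Y) = Z (g(X, Y)) - g([Z, X], Y) - g(X, [Z, Y])`. -/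
def lieDeriv (g : PseudoRiemannianMetric n M) (Z X Y : ∀ x : M, TangentSpace (𝓡 n) x)
    (x : M) : ℝ :=
  derivAlong Z (fun y => g.val y (X y) (Y y)) x
    - g.val x (VectorField.mlieBracket (𝓡 n) Z X x) (Y x)
    - g.val x (X x) (VectorField.mlieBracket (𝓡 n) Z Y x)

/-- `Z` is a Killing vector field of `g`: `𝔏_Z g = 0`. -/
def IsKilling (g : PseudoRiemannianMetric n M) (Z : ∀ x : M, TangentSpace (𝓡 n) x) : Prop :=
  SmoothField Z ∧ ∀ X Y : ∀ x : M, TangentSpace (𝓡 n) x, SmoothField X → SmoothField Y →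
    ∀ x, g.lieDeriv Z X Y x = 0

/-- `g` is a `δ`-almost Yamabe soliton with potential vector field `Z` and soliton function `lam`:
`(δ / 2) 𝔏_Z g = (r - lam) g`, where `r` is the scalar curvature of `g`, `Z` and `lam` are smooth
and `δ` has no zeros. -/
structure IsDeltaAlmostYamabeSoliton (g : PseudoRiemannianMetric n M) (δ lam : M → ℝ)
    (Z : ∀ x : M, TangentSpace (𝓡 n) x) : Prop where
  smooth_field : SmoothField Z
  smooth_lam : ContMDiff (𝓡 n) 𝓘(ℝ, ℝ) ∞ lam
  delta_ne_zero : ∀ x, δ x ≠ 0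
  soliton_eq : ∀ X Y : ∀ x : M, TangentSpace (𝓡 n) x, SmoothField X → SmoothField Y →
    ∀ x, δ x / 2 * g.lieDeriv Z X Y x = (g.scalarCurvature x - lam x) * g.val x (X x) (Y x)

end PseudoRiemannianMetric

/-! ## Paracontact metric structures -/

/-- An almost paracontact structure `(φ, ξ, η)`. -/
structure AlmostParacontactStructure (n : ℕ) (M : Type*) [TopologicalSpace M]
    [ChartedSpace (EuclideanSpace ℝ (Fin n)) M] [IsManifold (𝓡 n) ∞ M] where
  φ : ∀ x : M, TangentSpace (𝓡 n) x →L[ℝ] TangentSpace (𝓡 n) x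
  ξ : ∀ x : M, TangentSpace (𝓡 n) x
  η : ∀ x : M, TangentSpace (𝓡 n) x →L[ℝ] ℝ
  smooth_φ : ContMDiff (𝓡 n)
    ((𝓡 n).prod 𝓘(ℝ, EuclideanSpace ℝ (Fin n) →L[ℝ] EuclideanSpace ℝ (Fin n))) ∞
    (fun x => TotalSpace.mk' (EuclideanSpace ℝ (Fin n) →L[ℝ] EuclideanSpace ℝ (Fin n))
      (E := fun x : M => TangentSpace (𝓡 n) x →L[ℝ] TangentSpace (𝓡 n) x) x (φ x))
  smooth_ξ : SmoothField ξ
  smooth_η : ContMDiff (𝓡 n) ((𝓡 n).prod 𝓘(ℝ, EuclideanSpace ℝ (Fin n) →L[ℝ] ℝ)) ∞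
    (fun x => TotalSpace.mk' (EuclideanSpace ℝ (Fin n) →L[ℝ] ℝ)
      (E := fun x : M => TangentSpace (𝓡 n) x →L[ℝ] ℝ) x (η x))
  φ_sq : ∀ (x : M) (u : TangentSpace (𝓡 n) x), φ x (φ x u) = u - η x u • ξ x
  η_ξ : ∀ x, η x (ξ x) = 1
  φ_ξ : ∀ x, φ x (ξ x) = 0
  η_φ : ∀ (x : M) (u : TangentSpace (𝓡 n) x), η x (φ x u) = 0

/-- `(φ, ξ, η, g)` is a paracontact metric structure: `g` is compatible with `(φ, ξ, η)`, and the
fundamental `2`-form `Φ(X, Y) = g(X, φ Y)` equals `dη`. -/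
structure AlmostParacontactStructure.IsParacontactMetric {n : ℕ} {M : Type*} [TopologicalSpace M]
    [ChartedSpace (EuclideanSpace ℝ (Fin n)) M] [IsManifold (𝓡 n) ∞ M]
    (P : AlmostParacontactStructure n M) (g : PseudoRiemannianMetric n M) : Prop where
  compatible : ∀ (x : M) (u v : TangentSpace (𝓡 n) x),
    g.val x (P.φ x u) (P.φ x v) = -g.val x u v + P.η x u * P.η x v
  fundamental_eq : ∀ X Y : ∀ x : M, TangentSpace (𝓡 n) x, SmoothField X → SmoothField Y →
    ∀ x, g.val x (X x) (P.φ x (Y x)) = extDerivOneForm P.η X Y x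

end

/-! Put `μ = 2 (r - λ) / δ`, so that `𝔏_Z g = μ g`; it suffices to show `μ = 0`. Evaluating `𝔏_Z η`
and `𝔏_Z g` on `ξ` gives `μ = 2 σ` (`conformalFactor_eq`). As `𝔏_Z` commutes with `d`, on `ker η`
one has `𝔏_Z dη = σ dη`; with `dη = g(·, φ ·)` this becomes `𝔏_Z φ = (σ - μ) φ` there
(`val_lieDeriv_φ`). Differentiating `φ² = I - η ⊗ ξ` on `ker η`, modulo `ξ`, yields `2 (σ - μ) φ² =
0`, where `φ² = I`. Hence `σ = μ = 2 σ`, so both vanish (`contactFactor_eq_zero`). -/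

open VectorField

/-! ### Calculus of smooth vector fields: extensions, derivations, brackets. -/

section Fields

variable {n : ℕ} {M : Type*} [TopologicalSpace M] [ChartedSpace (EuclideanSpace ℝ (Fin n)) M]
  [IsManifold (𝓡 n) ∞ M] {X Y Z : ∀ x : M, TangentSpace (𝓡 n) x} {f h : M → ℝ}

namespace SmoothField

lemma mdifferentiableAt (hX : SmoothField X) (x : M) :
    MDifferentiableAt (𝓡 n) ((𝓡 n).prod 𝓘(ℝ, EuclideanSpace ℝ (Fin n)))
      (fun y => (X y : TangentBundle (𝓡 n) M)) x :=
  ContMDiffAt.mdifferentiableAt (hX x) (by simp)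

lemma smul (hf : ContMDiff (𝓡 n) 𝓘(ℝ, ℝ) ∞ f) (hX : SmoothField X) : SmoothField (f • X) :=
  ContMDiff.smul_section hf hX

lemma mlieBracket (hX : SmoothField X) (hY : SmoothField Y) :
    SmoothField (VectorField.mlieBracket (𝓡 n) X Y) := by
  have : IsManifold (𝓡 n) ((⊤ : ℕ∞) + 1) M := by
    simpa using (inferInstance : IsManifold (𝓡 n) ∞ M)
  have : IsManifold (𝓡 n) (minSmoothness ℝ 2) M :=
    .of_le (n := ∞) (by simp only [minSmoothness_of_isRCLikeNormedField]; exact ENat.LEInfty.out)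
  exact ContDiff.mlieBracket_vectorField (m := ⊤) (n := ⊤) hX hY (by simp)

/-- A smooth function is differentiated to a smooth function by a smooth vector field. -/
lemma derivAlong (hX : SmoothField X) (hf : ContMDiff (𝓡 n) 𝓘(ℝ, ℝ) ∞ f) :
    ContMDiff (𝓡 n) 𝓘(ℝ, ℝ) ∞ (derivAlong X f) := by
  -- `X f` is the fibre component of `Tf ∘ X`, a map into the tangent bundle of `ℝ`.
  have h := (contMDiff_snd_tangentBundle_modelSpace ℝ 𝓘(ℝ, ℝ)).comp
    ((hf.contMDiff_tangentMap (m := ∞) (by simp)).comp hX)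
  exact h

lemma contMDiff_oneForm {η : ∀ x : M, TangentSpace (𝓡 n) x →L[ℝ] ℝ}
    (hη : ContMDiff (𝓡 n) ((𝓡 n).prod 𝓘(ℝ, EuclideanSpace ℝ (Fin n) →L[ℝ] ℝ)) ∞
      (fun x => TotalSpace.mk' (EuclideanSpace ℝ (Fin n) →L[ℝ] ℝ)
        (E := fun x : M => TangentSpace (𝓡 n) x →L[ℝ] ℝ) x (η x)))
    (hX : SmoothField X) : ContMDiff (𝓡 n) 𝓘(ℝ, ℝ) ∞ (fun x => η x (X x)) := by
  intro x
  have := ContMDiffAt.clm_bundle_apply (F₁ := EuclideanSpace ℝ (Fin n)) (F₂ := ℝ)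
    (E₁ := fun x : M => TangentSpace (𝓡 n) x) (E₂ := Bundle.Trivial M ℝ) (hη x) (hX x)
  exact (contMDiffAt_section _).1 this

lemma endomorphism {φ : ∀ x : M, TangentSpace (𝓡 n) x →L[ℝ] TangentSpace (𝓡 n) x}
    (hφ : ContMDiff (𝓡 n)
      ((𝓡 n).prod 𝓘(ℝ, EuclideanSpace ℝ (Fin n) →L[ℝ] EuclideanSpace ℝ (Fin n))) ∞
      (fun x => TotalSpace.mk' (EuclideanSpace ℝ (Fin n) →L[ℝ] EuclideanSpace ℝ (Fin n))
        (E := fun x : M => TangentSpace (𝓡 n) x →L[ℝ] TangentSpace (𝓡 n) x) x (φ x)))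
    (hX : SmoothField X) : SmoothField (fun x => φ x (X x)) :=
  ContMDiff.clm_bundle_apply (F₁ := EuclideanSpace ℝ (Fin n)) (F₂ := EuclideanSpace ℝ (Fin n))
    (E₁ := fun x : M => TangentSpace (𝓡 n) x) (E₂ := fun x : M => TangentSpace (𝓡 n) x) hφ hX

end SmoothField

/-- Every tangent vector is the value of a smooth vector field. -/
lemma exists_smoothField_eq [T2Space M] (p : M) (u : TangentSpace (𝓡 n) p) :
    ∃ X : ∀ x : M, TangentSpace (𝓡 n) x, SmoothField X ∧ X p = u := by
  obtain ⟨s, hs, hsm⟩ := FiberBundle.exists_contMDiffOn_extend (k := ∞) (𝓡 n)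
    (EuclideanSpace ℝ (Fin n)) (V := fun x : M => TangentSpace (𝓡 n) x) u
  obtain ⟨t, hts, ht, hpt⟩ := mem_nhds_iff.1 hs
  -- The local extension is cut off by a bump function equal to `1` at `p` with closed support in
  -- `t`.
  obtain ⟨ψ, hψ, -⟩ := (SmoothBumpFunction.nhds_basis_support (I := 𝓡 n)
    (ht.mem_nhds hpt)).mem_iff.1 (ht.mem_nhds hpt)
  refine ⟨(ψ : M → ℝ) • FiberBundle.extend (EuclideanSpace ℝ (Fin n)) u, ?_, ?_⟩
  · exact ContMDiffOn.smul_section_of_tsupport ψ.contMDiff.contMDiffOn ht hψ (hsm.mono hts)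
  · simp

omit [IsManifold (𝓡 n) ∞ M] in
lemma ContMDiff.mdifferentiableAt_infty (hf : ContMDiff (𝓡 n) 𝓘(ℝ, ℝ) ∞ f) (x : M) :
    MDifferentiableAt (𝓡 n) 𝓘(ℝ, ℝ) f x :=
  (hf x).mdifferentiableAt (by simp)

omit [IsManifold (𝓡 n) ∞ M] in
lemma derivAlong_const (c : ℝ) (x : M) : derivAlong X (fun _ => c) x = 0 := by
  rw [derivAlong, mvfderiv_const]
  rfl

omit [IsManifold (𝓡 n) ∞ M] in
lemma derivAlong_add (hf : ContMDiff (𝓡 n) 𝓘(ℝ, ℝ) ∞ f) (hh : ContMDiff (𝓡 n) 𝓘(ℝ, ℝ) ∞ h)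
    (x : M) : derivAlong X (fun y => f y + h y) x = derivAlong X f x + derivAlong X h x := by
  have := mvfderiv_add (hf.mdifferentiableAt_infty x) (hh.mdifferentiableAt_infty x)
  exact congrArg (fun L => L (X x)) this

omit [IsManifold (𝓡 n) ∞ M] in
lemma derivAlong_mul (hf : ContMDiff (𝓡 n) 𝓘(ℝ, ℝ) ∞ f) (hh : ContMDiff (𝓡 n) 𝓘(ℝ, ℝ) ∞ h)
    (x : M) : derivAlong X (fun y => f y * h y) x
      = f x * derivAlong X h x + h x * derivAlong X f x := by
  have := mvfderiv_mul (hf.mdifferentiableAt_infty x) (hh.mdifferentiableAt_infty x)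
  exact congrArg (fun L => L (X x)) this

omit [IsManifold (𝓡 n) ∞ M] in
lemma derivAlong_sub (hf : ContMDiff (𝓡 n) 𝓘(ℝ, ℝ) ∞ f) (hh : ContMDiff (𝓡 n) 𝓘(ℝ, ℝ) ∞ h)
    (x : M) : derivAlong X (fun y => f y - h y) x = derivAlong X f x - derivAlong X h x := by
  have := mvfderiv_sub (hf.mdifferentiableAt_infty x) (hh.mdifferentiableAt_infty x)
  exact congrArg (fun L => L (X x)) this

lemma mlieBracket_smul_field (hf : ContMDiff (𝓡 n) 𝓘(ℝ, ℝ) ∞ f) (hY : SmoothField Y) :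
    mlieBracket (𝓡 n) X (f • Y) = derivAlong X f • Y + f • mlieBracket (𝓡 n) X Y := by
  funext x
  exact mlieBracket_smul_right (hf.mdifferentiableAt_infty x) (hY.mdifferentiableAt x)

lemma mlieBracket_add_field (hY : SmoothField Y) (hZ : SmoothField Z) :
    mlieBracket (𝓡 n) X (Y + Z) = mlieBracket (𝓡 n) X Y + mlieBracket (𝓡 n) X Z := by
  funext x
  exact mlieBracket_add_right (hY.mdifferentiableAt x) (hZ.mdifferentiableAt x)

lemma jacobi_identity (hX : SmoothField X) (hY : SmoothField Y) (hZ : SmoothField Z) :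
    mlieBracket (𝓡 n) X (mlieBracket (𝓡 n) Y Z)
      = mlieBracket (𝓡 n) (mlieBracket (𝓡 n) X Y) Z
        + mlieBracket (𝓡 n) Y (mlieBracket (𝓡 n) X Z) := by
  have h2 : minSmoothness ℝ 2 ≤ (∞ : WithTop ℕ∞) := by
    simp only [minSmoothness_of_isRCLikeNormedField]; exact ENat.LEInfty.out
  have : IsManifold (𝓡 n) (minSmoothness ℝ 3) M := .of_le (n := ∞)
    (by simp only [minSmoothness_of_isRCLikeNormedField]; exact ENat.LEInfty.out)
  exact leibniz_identity_mlieBracket (ContMDiff.of_le hX h2) (ContMDiff.of_le hY h2)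
    (ContMDiff.of_le hZ h2)

/-- `[X, Y] f = X (Y f) - Y (X f)`, by comparing the coefficients of `Z` in the Jacobi identity for
`X`, `Y`, `f Z`. -/
lemma derivAlong_mlieBracket [T2Space M] (hX : SmoothField X) (hY : SmoothField Y)
    (hf : ContMDiff (𝓡 n) 𝓘(ℝ, ℝ) ∞ f) (x : M) :
    derivAlong (mlieBracket (𝓡 n) X Y) f x
      = derivAlong X (derivAlong Y f) x - derivAlong Y (derivAlong X f) x := by
  -- In dimension zero there is no nonzero `Z x` to compare coefficients with, but all derivatives
  -- vanish.
  rcases subsingleton_or_nontrivial (TangentSpace (𝓡 n) x) with hs | hs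
  · have h0 (W : ∀ x : M, TangentSpace (𝓡 n) x) (k : M → ℝ) : derivAlong W k x = 0 := by
      rw [derivAlong, Subsingleton.elim (W x) 0, map_zero]
    simp [h0]
  obtain ⟨u, hu⟩ := exists_ne (0 : TangentSpace (𝓡 n) x)
  obtain ⟨Z, hZ, rfl⟩ := exists_smoothField_eq x u
  have J := congrFun (jacobi_identity hX hY (hZ.smul hf)) x
  have J' := congrFun (jacobi_identity hX hY hZ) x
  have hXf := hX.derivAlong hf
  have hYf := hY.derivAlong hf
  rw [mlieBracket_smul_field hf hZ, mlieBracket_smul_field hf hZ, mlieBracket_smul_field hf hZ,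
    mlieBracket_add_field (hZ.smul hYf) ((hY.mlieBracket hZ).smul hf),
    mlieBracket_add_field (hZ.smul hXf) ((hX.mlieBracket hZ).smul hf),
    mlieBracket_smul_field hYf hZ, mlieBracket_smul_field hXf hZ,
    mlieBracket_smul_field hf (hX.mlieBracket hZ),
    mlieBracket_smul_field hf (hY.mlieBracket hZ)] at J
  simp only [Pi.add_apply, Pi.smul_apply'] at J J'
  rw [J'] at J
  have : (derivAlong (mlieBracket (𝓡 n) X Y) f x
      - (derivAlong X (derivAlong Y f) x - derivAlong Y (derivAlong X f) x)) • Z x = 0 := by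
    linear_combination (norm := module) (-1 : ℝ) • J
  exact sub_eq_zero.1 ((smul_eq_zero.1 this).resolve_right hu)

end Fields

/-! ### Paracontact metric structures and conformal contact transformations. -/

section Paracontact

variable {n : ℕ} {M : Type*} [TopologicalSpace M] [T2Space M]
  [ChartedSpace (EuclideanSpace ℝ (Fin n)) M] [IsManifold (𝓡 n) ∞ M]

/-- If `𝔏_Z η = σ η`, then `2 𝔏_Z dη = 2 d(σ η)`, where
`2 d(σ η)(X, Y) = (X σ) η(Y) - (Y σ) η(X) + 2 σ dη(X, Y)`. -/
lemma lieDeriv_extDerivOneForm {η : ∀ x : M, TangentSpace (𝓡 n) x →L[ℝ] ℝ}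
    (hη : ContMDiff (𝓡 n) ((𝓡 n).prod 𝓘(ℝ, EuclideanSpace ℝ (Fin n) →L[ℝ] ℝ)) ∞
      (fun x => TotalSpace.mk' (EuclideanSpace ℝ (Fin n) →L[ℝ] ℝ)
        (E := fun x : M => TangentSpace (𝓡 n) x →L[ℝ] ℝ) x (η x)))
    {Z X Y : ∀ x : M, TangentSpace (𝓡 n) x} {σ : M → ℝ} (hZ : SmoothField Z)
    (hX : SmoothField X) (hY : SmoothField Y) (hσ : ContMDiff (𝓡 n) 𝓘(ℝ, ℝ) ∞ σ)
    (hc : ∀ X : ∀ x : M, TangentSpace (𝓡 n) x, SmoothField X →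
      ∀ x, lieDerivOneForm Z η X x = σ x * η x (X x)) (x : M) :
    2 * (derivAlong Z (extDerivOneForm η X Y) x
      - extDerivOneForm η (mlieBracket (𝓡 n) Z X) Y x
      - extDerivOneForm η X (mlieBracket (𝓡 n) Z Y) x)
    = derivAlong X σ x * η x (Y x) - derivAlong Y σ x * η x (X x)
      + 2 * (σ x * extDerivOneForm η X Y x) := by
  have hη' {W : ∀ x : M, TangentSpace (𝓡 n) x} (hW : SmoothField W) :
      ContMDiff (𝓡 n) 𝓘(ℝ, ℝ) ∞ (fun x => η x (W x)) := hW.contMDiff_oneForm hη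
  have hD {W : ∀ x : M, TangentSpace (𝓡 n) x} (hW : SmoothField W) :
      derivAlong Z (fun y => η y (W y))
        = fun y => σ y * η y (W y) + η y (mlieBracket (𝓡 n) Z W y) :=
    funext fun y => sub_eq_iff_eq_add.1 (hc W hW y)
  have hm {W : ∀ x : M, TangentSpace (𝓡 n) x} (hW : SmoothField W) :
      ContMDiff (𝓡 n) 𝓘(ℝ, ℝ) ∞ (fun x => σ x * η x (W x)) := hσ.mul (hη' hW)
  have hXY := hX.mlieBracket hY
  have hZX := hZ.mlieBracket hX
  have hZY := hZ.mlieBracket hY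
  have e1 : derivAlong Z (extDerivOneForm η X Y) x
      = (1 / 2) * (derivAlong Z (derivAlong X (fun y => η y (Y y))) x
        - derivAlong Z (derivAlong Y (fun y => η y (X y))) x
        - derivAlong Z (fun y => η y (mlieBracket (𝓡 n) X Y y)) x) := by
    have a1 := hX.derivAlong (hη' hY)
    have a2 := hY.derivAlong (hη' hX)
    rw [← derivAlong_sub a1 a2, ← derivAlong_sub (a1.sub a2) (hη' hXY)]
    refine (derivAlong_mul contMDiff_const ((a1.sub a2).sub (hη' hXY)) x).trans ?_
    simp only [derivAlong_const, mul_zero, add_zero]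
  -- Commuting `Z` past `X` and `Y` lets the contact condition be differentiated; this is where `X
  -- σ` and `Y σ` arise.
  have e2 := derivAlong_mlieBracket hZ hX (hη' hY) x
  have e3 := derivAlong_mlieBracket hZ hY (hη' hX) x
  rw [hD hY, derivAlong_add (hm hY) (hη' hZY), derivAlong_mul hσ (hη' hY)] at e2
  rw [hD hX, derivAlong_add (hm hX) (hη' hZX), derivAlong_mul hσ (hη' hX)] at e3
  -- The Jacobi identity cancels the iterated brackets.
  have e4 := congrArg (η x) (congrFun (jacobi_identity hZ hX hY) x)
  rw [Pi.add_apply, map_add] at e4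
  rw [e1, hD hXY]
  simp only [extDerivOneForm]
  rw [e2, e3]
  linear_combination -e4

variable {P : AlmostParacontactStructure n M} {g : PseudoRiemannianMetric n M}

namespace AlmostParacontactStructure.IsParacontactMetric

omit [T2Space M]

lemma val_ξ (hP : P.IsParacontactMetric g) (x : M) (u : TangentSpace (𝓡 n) x) :
    g.val x u (P.ξ x) = P.η x u := by
  have := hP.compatible x u (P.ξ x)
  rw [P.φ_ξ, map_zero, P.η_ξ] at this
  linarith

/-- Skew-adjointness of `φ` is compatibility for the pair `u`, `φ v`, since `φ² v` differs from `v`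
by a multiple of `ξ`, which is orthogonal to the image of `φ`. -/
lemma val_φ_left (hP : P.IsParacontactMetric g) (x : M) (u v : TangentSpace (𝓡 n) x) :
    g.val x (P.φ x u) v = -g.val x u (P.φ x v) := by
  have := hP.compatible x u (P.φ x v)
  rw [P.φ_sq, P.η_φ, map_sub, map_smul, hP.val_ξ, P.η_φ, smul_zero] at this
  linarith

/-- In dimension greater than one, `g` does not vanish identically on the kernel of `η`. -/
lemma exists_val_ne_zero (hP : P.IsParacontactMetric g) (hn : 1 < n) (x : M) :
    ∃ u v : TangentSpace (𝓡 n) x, P.η x u = 0 ∧ P.η x v = 0 ∧ g.val x u v ≠ 0 := by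
  obtain ⟨u, hu, hu0⟩ : ∃ u : TangentSpace (𝓡 n) x, P.η x u = 0 ∧ u ≠ 0 := by
    let L : EuclideanSpace ℝ (Fin n) →ₗ[ℝ] ℝ := (P.η x : TangentSpace (𝓡 n) x →ₗ[ℝ] ℝ)
    -- Here `1 < n` enters: `ker η` has dimension `n - 1`.
    have : LinearMap.ker L ≠ ⊥ := LinearMap.ker_ne_bot_of_finrank_lt (by simpa using hn)
    obtain ⟨u, hu, hu0⟩ := Submodule.exists_mem_ne_zero_of_ne_bot this
    exact ⟨u, hu, hu0⟩
  have : ¬ ∀ v, g.val x u v = 0 := fun h => hu0 (g.nondegenerate x u h)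
  push Not at this
  obtain ⟨v, hv⟩ := this
  -- Projecting `v` to `ker η` along `ξ` keeps the pairing, as `u` is orthogonal to `ξ`.
  refine ⟨u, v - P.η x v • P.ξ x, hu, ?_, ?_⟩
  · rw [map_sub, map_smul, P.η_ξ, smul_eq_mul, mul_one, sub_self]
  · rwa [map_sub, map_smul, hP.val_ξ, hu, smul_zero, sub_zero]

end AlmostParacontactStructure.IsParacontactMetric

variable {Z : ∀ x : M, TangentSpace (𝓡 n) x} {σ μ : M → ℝ}

omit [T2Space M] in
/-- If `𝔏_Z g = μ g` and `𝔏_Z η = σ η`, then `μ = 2 σ`. -/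
lemma conformalFactor_eq (hP : P.IsParacontactMetric g)
    (hc : ∀ X : ∀ x : M, TangentSpace (𝓡 n) x, SmoothField X →
      ∀ x, lieDerivOneForm Z P.η X x = σ x * P.η x (X x))
    (hg : ∀ X Y : ∀ x : M, TangentSpace (𝓡 n) x, SmoothField X → SmoothField Y →
      ∀ x, g.lieDeriv Z X Y x = μ x * g.val x (X x) (Y x)) (x : M) : μ x = 2 * σ x := by
  have h1 := hc P.ξ P.smooth_ξ x
  have h2 := hg P.ξ P.ξ P.smooth_ξ P.smooth_ξ x
  simp only [lieDerivOneForm, PseudoRiemannianMetric.lieDeriv, P.η_ξ, hP.val_ξ,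
    derivAlong_const, g.symm x (P.ξ x)] at h1 h2
  -- The two evaluations read `σ = -η [Z, ξ]` and `μ = -2 η [Z, ξ]`.
  linarith

/-- If `𝔏_Z g = μ g` and `𝔏_Z η = σ η`, then `𝔏_Z φ = (σ - μ) φ` on the kernel of `η`. -/
lemma val_lieDeriv_φ (hP : P.IsParacontactMetric g) (hZ : SmoothField Z)
    (hσ : ContMDiff (𝓡 n) 𝓘(ℝ, ℝ) ∞ σ)
    (hc : ∀ X : ∀ x : M, TangentSpace (𝓡 n) x, SmoothField X →
      ∀ x, lieDerivOneForm Z P.η X x = σ x * P.η x (X x))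
    (hg : ∀ X Y : ∀ x : M, TangentSpace (𝓡 n) x, SmoothField X → SmoothField Y →
      ∀ x, g.lieDeriv Z X Y x = μ x * g.val x (X x) (Y x))
    {X Y : ∀ x : M, TangentSpace (𝓡 n) x} (hX : SmoothField X) (hY : SmoothField Y) {x : M}
    (hηX : P.η x (X x) = 0) (hηY : P.η x (Y x) = 0) :
    g.val x (X x) (mlieBracket (𝓡 n) Z (fun y => P.φ y (Y y)) x
      - P.φ x (mlieBracket (𝓡 n) Z Y x)) = (σ x - μ x) * g.val x (X x) (P.φ x (Y x)) := by
  have h1 := lieDeriv_extDerivOneForm P.smooth_η hZ hX hY hσ hc x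
  have h2 := hg X _ hX (hY.endomorphism P.smooth_φ) x
  have h3 : (fun y => g.val y (X y) (P.φ y (Y y))) = extDerivOneForm P.η X Y :=
    funext (hP.fundamental_eq X Y hX hY)
  rw [PseudoRiemannianMetric.lieDeriv, h3] at h2
  -- The terms with derivatives of `σ` carry a factor `η(X)` or `η(Y)`, hence drop out at `x`.
  rw [← hP.fundamental_eq _ Y (hZ.mlieBracket hX) hY,
    ← hP.fundamental_eq X _ hX (hZ.mlieBracket hY), ← hP.fundamental_eq X Y hX hY,
    hηX, hηY] at h1
  rw [map_sub]
  linarith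

/-- On a paracontact metric manifold of dimension greater than one, a conformal infinitesimal
contact transformation preserves `η`. -/
lemma contactFactor_eq_zero (hn : 1 < n) (hP : P.IsParacontactMetric g) (hZ : SmoothField Z)
    (hσ : ContMDiff (𝓡 n) 𝓘(ℝ, ℝ) ∞ σ)
    (hc : ∀ X : ∀ x : M, TangentSpace (𝓡 n) x, SmoothField X →
      ∀ x, lieDerivOneForm Z P.η X x = σ x * P.η x (X x))
    (hg : ∀ X Y : ∀ x : M, TangentSpace (𝓡 n) x, SmoothField X → SmoothField Y →
      ∀ x, g.lieDeriv Z X Y x = μ x * g.val x (X x) (Y x)) (x : M) : σ x = 0 := by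
  obtain ⟨u, v, hu, hv, huv⟩ := hP.exists_val_ne_zero hn x
  obtain ⟨X, hX, rfl⟩ := exists_smoothField_eq x u
  obtain ⟨Y, hY, rfl⟩ := exists_smoothField_eq x v
  have hφX := hX.endomorphism P.smooth_φ
  have hφY := hY.endomorphism P.smooth_φ
  have hμ := conformalFactor_eq hP hc hg x
  have h1 := val_lieDeriv_φ hP hZ hσ hc hg hX hφY hu (P.η_φ x _)
  have h2 := val_lieDeriv_φ hP hZ hσ hc hg hφX hY (P.η_φ x _) hv
  have hηY : ContMDiff (𝓡 n) 𝓘(ℝ, ℝ) ∞ (fun y => P.η y (Y y)) := hY.contMDiff_oneForm P.smooth_η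
  -- `Y` lies in `ker η` only at `x`, and a bracket sees derivatives, so the `ξ` part is kept; its
  -- contribution is a multiple of `ξ`, orthogonal to `X`.
  have h3 : Y = (fun y => P.φ y (P.φ y (Y y))) + (fun y => P.η y (Y y)) • P.ξ := by
    funext y
    simp only [Pi.add_apply, Pi.smul_apply', P.φ_sq, sub_add_cancel]
  have h4 : mlieBracket (𝓡 n) Z Y x = mlieBracket (𝓡 n) Z (fun y => P.φ y (P.φ y (Y y))) x
      + derivAlong Z (fun y => P.η y (Y y)) x • P.ξ x := by
    conv_lhs => rw [h3]
    rw [mlieBracket_add_field (hφY.endomorphism P.smooth_φ) (P.smooth_ξ.smul hηY),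
      mlieBracket_smul_field hηY P.smooth_ξ]
    simp only [Pi.add_apply, Pi.smul_apply', hv, zero_smul, add_zero]
  have h5 := congrArg (g.val x (X x)) h4
  rw [map_add, map_smul, hP.val_ξ, hu, smul_zero, add_zero] at h5
  simp only [hP.val_φ_left, map_sub, P.φ_sq, map_smul, hP.val_ξ, hu, hv, smul_zero,
    sub_zero] at h1 h2 h5
  -- By `h5` the left sides of `h1` and `h2` agree, while the right sides are `(σ - μ) g(X, Y)` and
  -- its negative.
  have h6 : σ x * g.val x (X x) (Y x) = 0 := by
    rw [hμ] at h1 h2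
    linarith
  exact (mul_eq_zero.1 h6).resolve_right huv

end Paracontact

theorem mainTheorem1 {n : ℕ} (hn : 1 < n) {M : Type*} [TopologicalSpace M] [T2Space M]
    [ChartedSpace (EuclideanSpace ℝ (Fin n)) M] [IsManifold (𝓡 n) ∞ M]
    (P : AlmostParacontactStructure n M) (g : PseudoRiemannianMetric n M)
    (hP : P.IsParacontactMetric g) (δ lam : M → ℝ) (Z : ∀ x : M, TangentSpace (𝓡 n) x)
    (hZ : g.IsDeltaAlmostYamabeSoliton δ lam Z)
    (hc : IsInfinitesimalContactTransformation P.η Z) :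
    (∀ x, g.scalarCurvature x = lam x) ∧ g.IsKilling Z := by
  obtain ⟨σ, hσ, hc⟩ := hc
  have hg : ∀ X Y : ∀ x : M, TangentSpace (𝓡 n) x, SmoothField X → SmoothField Y →
      ∀ x, g.lieDeriv Z X Y x
        = (2 / δ x * (g.scalarCurvature x - lam x)) * g.val x (X x) (Y x) := by
    intro X Y hX hY x
    have := hZ.soliton_eq X Y hX hY x
    have hδ := hZ.delta_ne_zero x
    field_simp at this ⊢
    linarith
  have hμ : ∀ x, 2 / δ x * (g.scalarCurvature x - lam x) = 0 := fun x => by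
    rw [conformalFactor_eq hP hc hg x,
      contactFactor_eq_zero hn hP hZ.smooth_field hσ hc hg x, mul_zero]
  refine ⟨fun x => ?_, hZ.smooth_field, fun X Y hX hY x => ?_⟩
  · exact sub_eq_zero.1
      ((mul_eq_zero.1 (hμ x)).resolve_left (div_ne_zero two_ne_zero (hZ.delta_ne_zero x)))
  · rw [hg X Y hX hY, hμ, zero_mul]
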